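/- Let $n\ge 1$, $d\ge n$ and $M\ge 1$ be integers, and let $\mathbf Y=[\mathbf y_1\cdots\mathbf y_M]\in\mathbb R^{n\times M}$ be a matrix of regression targets with mean $\bar{\mathbf y}=M^{-1}\sum_{i=1}^M\mathbf y_i$. Put $\bar{\mathbf Y}=[\bar{\mathbf y}\cdots\bar{\mathbf y}]\in\mathbb R^{n\times M}$, and assume that the sample covariance matrix $\mathbf\Sigma=M^{-1}(\mathbf Y-\bar{\mathbf Y})(\mathbf Y-\bar{\mathbf Y})^T$ has full rank $n$. Let $\lambda_1\ge\cdots\ge\lambda_n=:\lambda_{\min}>0$ be the eigenvalues of $\mathbf\Sigma$. Let $\lambda_{\mathbf H},\lambda_{\mathbf W}>0$, $c:=\lambda_{\mathbf H}\lambda_{\mathbf W}$, and $j^*:=\max\{j:\lambda_j\ge c\}$, with $j^*:=0$ if there is no such $j$. Let $\mathrm{MSE}(\text{no-whitening}):=M^{-1}\|\mathbf W\mathbf H+\mathbf b\mathbf 1_M^T-\mathbf Y\|_F^2$, where $(\mathbf H,\mathbf W,\mathbf b)$ is a global minimizer over $\mathbb R^{d\times M}\times\mathbb R^{n\times d}\times\mathbb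 R^n$ of the unconstrained feature model (UFM) loss $$\frac1{2M}\|\mathbf W\mathbf H+\mathbf b\mathbf 1_M^T-\mathbf Y\|_F^2+\frac{\lambda_{\mathbf H}}{2M}\|\mathbf H\|_F^2+\frac{\lambda_{\mathbf W}}2\|\mathbf W\|_F^2 .$$ Let $\mathrm{MSE}(\text{de-whiten}):=M^{-1}\|\mathbf\Sigma^{1/2}\tilde{\mathbf W}\tilde{\mathbf H}+\bar{\mathbf Y}-\mathbf Y\|_F^2$, where $(\tilde{\mathbf H},\tilde{\mathbf W})$ is a global minimizer over $\mathbb R^{d\times M}\times\mathbb R^{n\times d}$ of $$\frac1{2M}\|\mathbf W\mathbf H-\mathbf Y^{ZCA}\|_F^2+\frac{\lambda_{\mathbf H}}{2M}\|\mathbf H\|_F^2+\frac{\lambda_{\mathbf W}}2\|\mathbf W\|_F^2,\qquad \mathbf Y^{ZCA}:=\mathbf\Sigma^{-1/2}(\mathbf Y-\bar{\mathbf Y}).$$ Both numbers are well defined (global minimizers exist, and each number is the same for all of them), and the following holds. (i) Suppose $0<c\le1$. Then $\mathrm{MSE}(\text{de-whiten})$ is strictly smaller than, strictly larger than, or equal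 to $\mathrm{MSE}(\text{no-whitening})$ according as $$\sum_{i=1}^{j^*}\lambda_i-j^*\quad\text{is}\ <,\ >,\ \text{or}\ =\quad c^{-1}(1-c)\sum_{i=j^*+1}^n\lambda_i .$$ If moreover $c<\lambda_{\min}$, then $j^*=n$, and the displayed relation $<$, $>$, $=$ holds if and only if $\bar\lambda:=\frac1n\sum_{i=1}^n\lambda_i$ is respectively $<1$, $>1$, $=1$. (ii) Suppose $c>1$. Then $\mathrm{MSE}(\text{de-whiten})\ge\mathrm{MSE}(\text{no-whitening})$, with equality if and only if $\lambda_i=c$ for all $i\le j^*$. -/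

import Mathlib

open scoped MatrixOrder Matrix.Norms.L2Operator

/-- The squared Frobenius norm of a real matrix. -/
def frobSq {p q : ℕ} (A : Matrix (Fin p) (Fin q) ℝ) : ℝ :=
  ∑ i, ∑ j, A i j ^ 2

/-- The sample mean of the targets, which are the `M` columns of `Y`. -/
noncomputable def targetMean {n M : ℕ} (Y : Matrix (Fin n) (Fin M) ℝ) : Fin n → ℝ :=
  fun i => (M : ℝ)⁻¹ * ∑ k, Y i k

/-- The matrix all of whose `M` columns are equal to the sample mean of the targets. -/
noncomputable def meanMatrix {n M : ℕ} (Y : Matrix (Fin n) (Fin M) ℝ) :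
    Matrix (Fin n) (Fin M) ℝ :=
  Matrix.replicateCol (Fin M) (targetMean Y)

/-- The sample covariance matrix of the targets. -/
noncomputable def targetCov {n M : ℕ} (Y : Matrix (Fin n) (Fin M) ℝ) :
    Matrix (Fin n) (Fin n) ℝ :=
  (M : ℝ)⁻¹ • ((Y - meanMatrix Y) * (Y - meanMatrix Y).transpose)

theorem targetCov_isHermitian {n M : ℕ} (Y : Matrix (Fin n) (Fin M) ℝ) :
    (targetCov Y).IsHermitian := by
  simp [Matrix.IsHermitian, targetCov, Matrix.conjTranspose_eq_transpose_of_trivial,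
    Matrix.transpose_smul, Matrix.transpose_mul]

/-- The eigenvalues of the sample covariance matrix, with multiplicity, in descending order:
the entry with index `i : Fin n` is the `(i + 1)`-st largest eigenvalue. -/
noncomputable def targetEigenvalue {n M : ℕ} (Y : Matrix (Fin n) (Fin M) ℝ) (i : Fin n) : ℝ :=
  (targetCov_isHermitian Y).eigenvalues₀ (Fin.cast (Fintype.card_fin n).symm i)

/-- The largest (one-based) position `j` such that the `j`-th largest eigenvalue is at least `c`,
and `0` if there is no such position. -/
noncomputable def jStar {n M : ℕ} (Y : Matrix (Fin n) (Fin M) ℝ) (c : ℝ) : ℕ :=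
  (Finset.univ.filter (fun i : Fin n => c ≤ targetEigenvalue Y i)).sup (fun i => (i : ℕ) + 1)

/-- The sum of the `jStar Y c` largest eigenvalues. -/
noncomputable def headSum {n M : ℕ} (Y : Matrix (Fin n) (Fin M) ℝ) (c : ℝ) : ℝ :=
  ∑ i ∈ Finset.univ.filter (fun i : Fin n => (i : ℕ) < jStar Y c), targetEigenvalue Y i

/-- The sum of the other eigenvalues. -/
noncomputable def tailSum {n M : ℕ} (Y : Matrix (Fin n) (Fin M) ℝ) (c : ℝ) : ℝ :=
  ∑ i ∈ Finset.univ.filter (fun i : Fin n => jStar Y c ≤ (i : ℕ)), targetEigenvalue Y i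

/-- The ZCA-whitened targets. `CFC.sqrt` is the positive semidefinite square root. -/
noncomputable def whitenedTargets {n M : ℕ} (Y : Matrix (Fin n) (Fin M) ℝ) :
    Matrix (Fin n) (Fin M) ℝ :=
  (CFC.sqrt (targetCov Y))⁻¹ * (Y - meanMatrix Y)

/-- The regularized loss of the unconstrained feature model with bias. -/
noncomputable def ufmLoss {n d M : ℕ} (lamH lamW : ℝ) (Y : Matrix (Fin n) (Fin M) ℝ)
    (H : Matrix (Fin d) (Fin M) ℝ) (W : Matrix (Fin n) (Fin d) ℝ) (b : Fin n → ℝ) : ℝ :=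
  1 / (2 * (M : ℝ)) * frobSq (W * H + Matrix.replicateCol (Fin M) b - Y)
    + lamH / (2 * (M : ℝ)) * frobSq H + lamW / 2 * frobSq W

/-- The training mean squared error of the unconstrained feature model with bias. -/
noncomputable def ufmMSE {n d M : ℕ} (Y : Matrix (Fin n) (Fin M) ℝ)
    (H : Matrix (Fin d) (Fin M) ℝ) (W : Matrix (Fin n) (Fin d) ℝ) (b : Fin n → ℝ) : ℝ :=
  1 / (M : ℝ) * frobSq (W * H + Matrix.replicateCol (Fin M) b - Y)

/-- The training errors, on the unprocessed targets, of the global minimizers of the loss with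
feature dimension `d`. -/
def noWhiteningMSEs {n M : ℕ} (d : ℕ) (lamH lamW : ℝ) (Y : Matrix (Fin n) (Fin M) ℝ) : Set ℝ :=
  {m | ∃ (H : Matrix (Fin d) (Fin M) ℝ) (W : Matrix (Fin n) (Fin d) ℝ) (b : Fin n → ℝ),
    (∀ (H' : Matrix (Fin d) (Fin M) ℝ) (W' : Matrix (Fin n) (Fin d) ℝ) (b' : Fin n → ℝ),
      ufmLoss lamH lamW Y H W b ≤ ufmLoss lamH lamW Y H' W' b') ∧
    m = ufmMSE Y H W b}

/-- The regularized loss of the unconstrained feature model without bias, used for training on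
the whitened (hence centred) targets. -/
noncomputable def ufmLossNoBias {n d M : ℕ} (lamH lamW : ℝ) (Y : Matrix (Fin n) (Fin M) ℝ)
    (H : Matrix (Fin d) (Fin M) ℝ) (W : Matrix (Fin n) (Fin d) ℝ) : ℝ :=
  1 / (2 * (M : ℝ)) * frobSq (W * H - Y)
    + lamH / (2 * (M : ℝ)) * frobSq H + lamW / 2 * frobSq W

/-- The predictions `W * H` for the whitened targets, transformed back to the original targets. -/
noncomputable def deWhitenedPrediction {n d M : ℕ} (Y : Matrix (Fin n) (Fin M) ℝ)
    (H : Matrix (Fin d) (Fin M) ℝ) (W : Matrix (Fin n) (Fin d) ℝ) : Matrix (Fin n) (Fin M) ℝ :=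
  CFC.sqrt (targetCov Y) * (W * H) + meanMatrix Y

/-- The errors, on the unprocessed targets, of the de-whitened predictions of the global
minimizers, with feature dimension `d`, of the loss for the whitened targets. -/
def deWhitenMSEs {n M : ℕ} (d : ℕ) (lamH lamW : ℝ) (Y : Matrix (Fin n) (Fin M) ℝ) : Set ℝ :=
  {m | ∃ (H : Matrix (Fin d) (Fin M) ℝ) (W : Matrix (Fin n) (Fin d) ℝ),
    (∀ (H' : Matrix (Fin d) (Fin M) ℝ) (W' : Matrix (Fin n) (Fin d) ℝ),
      ufmLossNoBias lamH lamW (whitenedTargets Y) H W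
      ≤ ufmLossNoBias lamH lamW (whitenedTargets Y) H' W') ∧
    m = 1 / (M : ℝ) * frobSq (deWhitenedPrediction Y H W - Y)}

/-! Both errors have closed forms. Let X be the centred or the whitened targets, with X Xᵀ = M·U
diag(λ) Uᵀ, and let c = lamH·lamW. Minimized over factorizations, the penalty is a multiple of the
nuclear norm of the prediction, so the optimum soft-thresholds the singular values of X: the
residual R has squared singular values M·min(λᵢ, c). `regularization_ge` is the dual certificate:
since the spectral norm of R is at most √(M c), the inner product of WH with R is at most half the
penalty. Expanding the square about X − R, `exists_soft_threshold` bounds the excess loss below by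
the squared distance of the prediction from X − R, so all minimizers share one residual.

Without whitening the error is thus ∑ min(λᵢ, c) = j*·c + tail. Whitened targets have identity
covariance, so R Rᵀ = M·min(1, c)·1, and de-whitening yields min(1, c)·tr Σ = min(1, c)·(head +
tail). The theorem compares these two numbers; for c > 1 it rests on head ≥ j*·c. -/

/-! ### Frobenius norm identities -/

theorem frobSq_eq_trace {p q : ℕ} (A : Matrix (Fin p) (Fin q) ℝ) :
    frobSq A = (A * A.transpose).trace := by
  simp [frobSq, Matrix.trace, Matrix.mul_apply, sq]

theorem frobSq_nonneg {p q : ℕ} (A : Matrix (Fin p) (Fin q) ℝ) : 0 ≤ frobSq A :=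
  Finset.sum_nonneg fun _ _ => Finset.sum_nonneg fun _ _ => sq_nonneg _

theorem frobSq_eq_zero_iff {p q : ℕ} {A : Matrix (Fin p) (Fin q) ℝ} : frobSq A = 0 ↔ A = 0 := by
  constructor
  · intro h
    ext i j
    have h1 := (Finset.sum_eq_zero_iff_of_nonneg
      (fun i _ => Finset.sum_nonneg fun j _ => sq_nonneg (A i j))).1 h i (Finset.mem_univ i)
    have h2 := (Finset.sum_eq_zero_iff_of_nonneg (fun j _ => sq_nonneg (A i j))).1 h1 j
      (Finset.mem_univ j)
    simpa using h2
  · rintro rfl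
    simp [frobSq]

theorem frobSq_transpose {p q : ℕ} (A : Matrix (Fin p) (Fin q) ℝ) :
    frobSq A.transpose = frobSq A := by
  rw [frobSq, Finset.sum_comm]
  rfl

theorem frobSq_smul {p q : ℕ} (r : ℝ) (A : Matrix (Fin p) (Fin q) ℝ) :
    frobSq (r • A) = r ^ 2 * frobSq A := by
  simp [frobSq, Finset.mul_sum, mul_pow]

theorem frobSq_sub {p q : ℕ} (A B : Matrix (Fin p) (Fin q) ℝ) :
    frobSq (A - B) = frobSq A - 2 * (A * B.transpose).trace + frobSq B := by
  simp only [frobSq, Matrix.trace, Matrix.mul_apply, Finset.mul_sum, Matrix.diag,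
    ← Finset.sum_sub_distrib, ← Finset.sum_add_distrib]
  refine Finset.sum_congr rfl fun i _ => Finset.sum_congr rfl fun j _ => ?_
  simp only [Matrix.sub_apply, Matrix.transpose_apply]
  ring

/-- If `R * Rᵀ` is orthogonally diagonalized by `U`, then `‖Wᵀ R‖²` is the sum of the squares of
the entries of `Uᵀ W`, weighted by the eigenvalues. -/
theorem frobSq_transpose_mul_of_diagonalization {n d M : ℕ} {U : Matrix (Fin n) (Fin n) ℝ}
    {m : Fin n → ℝ} {R : Matrix (Fin n) (Fin M) ℝ}
    (hR : R * R.transpose = U * Matrix.diagonal m * U.transpose) (W : Matrix (Fin n) (Fin d) ℝ) :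
    frobSq (W.transpose * R) = ∑ i, m i * ∑ j, (U.transpose * W) i j ^ 2 := by
  have h : (W.transpose * R) * (W.transpose * R).transpose =
      (U.transpose * W).transpose * (Matrix.diagonal m * (U.transpose * W)) := by
    rw [Matrix.transpose_mul, Matrix.transpose_mul, Matrix.transpose_transpose,
      Matrix.transpose_transpose, Matrix.mul_assoc, ← Matrix.mul_assoc R, hR]
    simp only [Matrix.mul_assoc]
  rw [frobSq_eq_trace, h, Matrix.trace_mul_comm]
  generalize U.transpose * W = V
  simp only [Matrix.trace, Matrix.diag, Matrix.mul_assoc, Matrix.diagonal_mul, Finset.mul_sum]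
  refine Finset.sum_congr rfl fun i _ => ?_
  rw [Matrix.mul_apply, Finset.mul_sum]
  refine Finset.sum_congr rfl fun j _ => ?_
  rw [Matrix.transpose_apply]
  ring

theorem frobSq_orthogonal_mul {n d : ℕ} {U : Matrix (Fin n) (Fin n) ℝ}
    (hU : U * U.transpose = 1) (W : Matrix (Fin n) (Fin d) ℝ) :
    frobSq (U.transpose * W) = frobSq W := by
  rw [← frobSq_transpose W, ← Matrix.mul_one W.transpose,
    frobSq_transpose_mul_of_diagonalization (U := U) (m := fun _ => 1) (R := 1) (by simp [hU])]
  simp [frobSq]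

/-! ### The regularized factorization problem -/

/-- Expand 0 ≤ ‖aH − WᵀR‖² and bound ‖WᵀR‖² by ab‖W‖², as the eigenvalues of R Rᵀ are at most ab;
then divide by a. -/
theorem regularization_ge {n d M : ℕ} {U : Matrix (Fin n) (Fin n) ℝ}
    (hU : U * U.transpose = 1) {m : Fin n → ℝ} {R : Matrix (Fin n) (Fin M) ℝ}
    (hR : R * R.transpose = U * Matrix.diagonal m * U.transpose)
    {a b : ℝ} (ha : 0 < a) (hm : ∀ i, m i ≤ a * b)
    (W : Matrix (Fin n) (Fin d) ℝ) (H : Matrix (Fin d) (Fin M) ℝ) :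
    2 * (W * H * R.transpose).trace ≤ a * frobSq H + b * frobSq W := by
  have h1 : frobSq (W.transpose * R) ≤ a * b * frobSq W := by
    rw [frobSq_transpose_mul_of_diagonalization hR, ← frobSq_orthogonal_mul hU W, frobSq,
      Finset.mul_sum]
    exact Finset.sum_le_sum fun i _ =>
      mul_le_mul_of_nonneg_right (hm i) (Finset.sum_nonneg fun _ _ => sq_nonneg _)
  have h2 := frobSq_nonneg (a • H - W.transpose * R)
  have h3 : (H * (W.transpose * R).transpose).trace = (W * H * R.transpose).trace := by
    rw [Matrix.transpose_mul, Matrix.transpose_transpose, ← Matrix.mul_assoc,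
      Matrix.trace_mul_comm, Matrix.mul_assoc]
  rw [frobSq_sub, frobSq_smul, Matrix.smul_mul, Matrix.trace_smul, h3, smul_eq_mul] at h2
  have h4 : 0 ≤ a * (a * frobSq H + b * frobSq W - 2 * (W * H * R.transpose).trace) := by
    nlinarith
  linarith [nonneg_of_mul_nonneg_right h4 ha]

/-- Here d ≥ n enters: E extends an n × n factor to d columns without changing its product with its
own transpose. -/
theorem exists_orthonormal_rows {n d : ℕ} (hd : n ≤ d) :
    ∃ E : Matrix (Fin n) (Fin d) ℝ, E * E.transpose = 1 := by
  refine ⟨(1 : Matrix (Fin d) (Fin d) ℝ).submatrix (Fin.castLE hd) id, ?_⟩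
  ext i j
  rw [Matrix.mul_apply, Finset.sum_eq_single (Fin.castLE hd i)]
  · simp [Matrix.one_apply, Fin.ext_iff, eq_comm]
  · intro x _ hx
    simp [Matrix.one_apply, hx.symm]
  · simp

/-- Soft thresholding of singular values solves the regularized factorization problem: the
residual `R` has squared singular values `M * min (lam i) (lamH * lamW)`, and every other
prediction has a loss that is larger by at least its squared distance from `X - R`. -/
theorem exists_soft_threshold {n d M : ℕ} (hd : n ≤ d) {U : Matrix (Fin n) (Fin n) ℝ}
    (hU : U * U.transpose = 1) {lam : Fin n → ℝ} (hlam : ∀ i, 0 < lam i)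
    {X : Matrix (Fin n) (Fin M) ℝ}
    (hX : X * X.transpose = (M : ℝ) • (U * Matrix.diagonal lam * U.transpose))
    {lamH lamW : ℝ} (hH : 0 < lamH) (hW : 0 < lamW) :
    ∃ (R : Matrix (Fin n) (Fin M) ℝ) (W₀ : Matrix (Fin n) (Fin d) ℝ)
      (H₀ : Matrix (Fin d) (Fin M) ℝ) (K : ℝ),
      (∃ D : Matrix (Fin n) (Fin n) ℝ, R = D * X) ∧
      R * R.transpose = (M : ℝ) •
        (U * Matrix.diagonal (fun i => min (lam i) (lamH * lamW)) * U.transpose) ∧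
      (∀ (W : Matrix (Fin n) (Fin d) ℝ) (H : Matrix (Fin d) (Fin M) ℝ)
        (B : Matrix (Fin n) (Fin M) ℝ), (B * R.transpose).trace = 0 →
        frobSq (W * H + B - (X - R)) + K ≤
          frobSq (W * H + B - X) + lamH * frobSq H + M * lamW * frobSq W) ∧
      frobSq (W₀ * H₀ - X) + lamH * frobSq H₀ + M * lamW * frobSq W₀ = K := by
  have hU' : U.transpose * U = 1 := mul_eq_one_comm.1 hU
  have hconj : ∀ a b : Fin n → ℝ,
      (U * Matrix.diagonal a * U.transpose) * (U * Matrix.diagonal b * U.transpose) =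
        U * Matrix.diagonal (fun i => a i * b i) * U.transpose := by
    intro a b
    rw [← Matrix.diagonal_mul_diagonal]
    simp only [Matrix.mul_assoc]
    rw [← Matrix.mul_assoc U.transpose U, hU', Matrix.one_mul]
  have hsymm : ∀ a : Fin n → ℝ, (U * Matrix.diagonal a * U.transpose).transpose =
      U * Matrix.diagonal a * U.transpose := by
    intro a
    simp [Matrix.transpose_mul, Matrix.mul_assoc]
  set c := lamH * lamW with hc
  have hc0 : 0 < c := mul_pos hH hW
  -- Ratio of the thresholded singular value of R to that of X: √min(λᵢ, c) / √λᵢ.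
  set s : Fin n → ℝ := fun i => min 1 (Real.sqrt (c / lam i)) with hs
  have hs0 : ∀ i, 0 < s i := fun i =>
    lt_min one_pos (Real.sqrt_pos.2 (div_pos hc0 (hlam i)))
  have hs1 : ∀ i, s i ≤ 1 := fun i => min_le_left _ _
  have hcase : ∀ i, (s i = 1 ∧ lam i ≤ c) ∨ (s i ^ 2 * lam i = c ∧ c ≤ lam i) := by
    intro i
    rcases le_total (lam i) c with h | h
    · left
      refine ⟨min_eq_left ?_, h⟩
      rw [Real.one_le_sqrt, one_le_div (hlam i)]
      exact h
    · right
      refine ⟨?_, h⟩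
      have : s i = Real.sqrt (c / lam i) := by
        apply min_eq_right
        exact Real.sqrt_le_one.2 ((div_le_one (hlam i)).2 h)
      rw [this, Real.sq_sqrt (div_pos hc0 (hlam i)).le, div_mul_cancel₀ _ (hlam i).ne']
  have hsm : ∀ i, s i ^ 2 * lam i = min (lam i) c := by
    intro i
    rcases hcase i with ⟨h1, h2⟩ | ⟨h1, h2⟩
    · rw [h1, min_eq_left h2]; ring
    · rw [h1, min_eq_right h2]
  set D := U * Matrix.diagonal s * U.transpose with hD
  set R := D * X with hRdef
  have hRR : R * R.transpose = (M : ℝ) •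
        (U * Matrix.diagonal (fun i => min (lam i) c) * U.transpose) := by
    rw [hRdef, Matrix.transpose_mul, Matrix.mul_assoc, ← Matrix.mul_assoc X, hX, hsymm,
      Matrix.smul_mul, Matrix.mul_smul, hconj, hconj]
    congr 4
    ext i
    rw [← hsm]
    ring
  have hRR' : R * R.transpose =
      U * Matrix.diagonal (fun i => M * min (lam i) c) * U.transpose := by
    rw [hRR, ← Matrix.smul_mul, ← Matrix.mul_smul, ← Matrix.diagonal_smul]
    rfl
  obtain ⟨E, hE⟩ := exists_orthonormal_rows hd
  -- Chosen so that t² s / lamH = 1 − s, which makes W₀H₀ = X − R.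
  set t : Fin n → ℝ := fun i => Real.sqrt (lamH * (1 - s i) / s i) with ht
  have ht2 : ∀ i, t i ^ 2 = lamH * (1 - s i) / s i := fun i =>
    Real.sq_sqrt (div_nonneg (mul_nonneg hH.le (sub_nonneg.2 (hs1 i))) (hs0 i).le)
  set W₀ := U * Matrix.diagonal t * E with hW₀
  -- Stationarity in H: lamH·H = Wᵀ(X − WH) = WᵀR.
  set H₀ := lamH⁻¹ • (W₀.transpose * R) with hH₀
  have hWW : W₀ * W₀.transpose = U * Matrix.diagonal (fun i => t i ^ 2) * U.transpose := by
    simp only [hW₀, Matrix.transpose_mul, Matrix.diagonal_transpose, sq,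
      ← Matrix.diagonal_mul_diagonal, Matrix.mul_assoc]
    rw [← Matrix.mul_assoc E, hE, Matrix.one_mul]
  have hWH : W₀ * H₀ = X - R := by
    rw [hH₀, Matrix.mul_smul, ← Matrix.mul_assoc, hWW, hRdef, ← Matrix.mul_assoc, hD, hconj,
      ← Matrix.smul_mul, ← Matrix.smul_mul, ← Matrix.mul_smul, ← Matrix.diagonal_smul]
    have : (lamH⁻¹ • fun i => t i ^ 2 * s i) = fun i => 1 - s i := by
      ext i
      have := (hs0 i).ne'
      rw [Pi.smul_apply, ht2, smul_eq_mul]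
      field_simp
    rw [this, ← Matrix.diagonal_sub, Matrix.diagonal_one, Matrix.mul_sub, Matrix.sub_mul,
      Matrix.mul_one, hU, Matrix.sub_mul, Matrix.one_mul]
  have hHW : lamH * frobSq H₀ = M * lamW * frobSq W₀ := by
    have hUW : U.transpose * W₀ = Matrix.diagonal t * E := by
      rw [hW₀, Matrix.mul_assoc U, ← Matrix.mul_assoc, hU', Matrix.one_mul]
    rw [hH₀, frobSq_smul, frobSq_transpose_mul_of_diagonalization hRR',
      ← frobSq_orthogonal_mul hU W₀, frobSq, hUW, Finset.mul_sum, Finset.mul_sum, Finset.mul_sum]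
    refine Finset.sum_congr rfl fun i _ => ?_
    simp only [Matrix.diagonal_mul, mul_pow, ← Finset.mul_sum]
    -- Below the threshold s = 1, so t vanishes; above it the minimum is c.
    have key : min (lam i) c * t i ^ 2 = c * t i ^ 2 := by
      rcases hcase i with ⟨h1, -⟩ | ⟨-, h2⟩
      · rw [ht2, h1]; simp
      · rw [min_eq_right h2]
    calc _ = lamH * (lamH⁻¹ ^ 2 * (M * ((min (lam i) c * t i ^ 2) * ∑ j, E i j ^ 2))) := by ring
      _ = _ := by rw [key, hc]; field_simp
  have hHH : lamH * frobSq H₀ = ((X - R) * R.transpose).trace := by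
    rw [← hWH, frobSq_eq_trace, Matrix.mul_assoc, Matrix.trace_mul_comm W₀, Matrix.mul_assoc,
      ← smul_eq_mul, ← Matrix.trace_smul, ← Matrix.mul_smul, ← Matrix.transpose_smul]
    congr 2
    rw [hH₀, smul_smul, mul_inv_cancel₀ hH.ne', one_smul, Matrix.transpose_mul,
      Matrix.transpose_transpose]
  -- By `hHW` and `hHH` each penalty term at the optimum equals tr((X − R)Rᵀ), and the squared error
  -- is ‖R‖².
  refine ⟨R, W₀, H₀, 2 * ((X - R) * R.transpose).trace + frobSq R, ⟨D, rfl⟩, hRR, ?_, ?_⟩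
  · intro W H B hB
    have hreg := regularization_ge hU hRR' hH (b := M * lamW) (fun i => by
      calc (M : ℝ) * min (lam i) c ≤ M * c :=
            mul_le_mul_of_nonneg_left (min_le_right _ _) (Nat.cast_nonneg M)
        _ = lamH * (M * lamW) := by rw [hc]; ring) W H
    have hsplit : W * H + B - X = (W * H + B - (X - R)) - R := by abel
    have htr : ((W * H + B - (X - R)) * R.transpose).trace =
        (W * H * R.transpose).trace - ((X - R) * R.transpose).trace := by
      rw [Matrix.sub_mul (W * H + B), Matrix.add_mul, Matrix.trace_sub, Matrix.trace_add, hB,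
        add_zero]
    rw [hsplit, frobSq_sub (W * H + B - (X - R)) R, htr]
    linarith
  · have : W₀ * H₀ - X = (-1 : ℝ) • R := by rw [hWH]; simp
    rw [this, frobSq_smul, ← hHW, hHH]
    ring

/-! ### The sample covariance and its spectrum -/

theorem targetCov_posSemidef {n M : ℕ} (Y : Matrix (Fin n) (Fin M) ℝ) :
    (targetCov Y).PosSemidef := by
  have h := Matrix.posSemidef_self_mul_conjTranspose (Y - meanMatrix Y)
  rw [Matrix.conjTranspose_eq_transpose_of_trivial] at h
  exact h.smul (inv_nonneg.2 (Nat.cast_nonneg M))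

theorem centered_mul_transpose {n M : ℕ} (hM : M ≠ 0) (Y : Matrix (Fin n) (Fin M) ℝ) :
    (Y - meanMatrix Y) * (Y - meanMatrix Y).transpose = (M : ℝ) • targetCov Y := by
  rw [targetCov, smul_smul, mul_inv_cancel₀ (Nat.cast_ne_zero.2 hM), one_smul]

theorem sum_centered {n M : ℕ} (hM : M ≠ 0) (Y : Matrix (Fin n) (Fin M) ℝ) (l : Fin n) :
    ∑ k, (Y - meanMatrix Y) l k = 0 := by
  have hM' : (M : ℝ) ≠ 0 := Nat.cast_ne_zero.2 hM
  simp [meanMatrix, targetMean, hM']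

/-- The rows of the centred targets sum to zero, so a bias error is orthogonal to the residual R = D
X. -/
theorem trace_replicateCol_mul_centered {n M : ℕ} (hM : M ≠ 0) (Y : Matrix (Fin n) (Fin M) ℝ)
    (v : Fin n → ℝ) (D : Matrix (Fin n) (Fin n) ℝ) :
    (Matrix.replicateCol (Fin M) v * (D * (Y - meanMatrix Y)).transpose).trace = 0 := by
  rw [Matrix.trace]
  refine Finset.sum_eq_zero fun i _ => ?_
  simp only [Matrix.diag, Matrix.mul_apply, Matrix.transpose_apply, Matrix.replicateCol_apply]
  rw [← Finset.mul_sum, Finset.sum_comm]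
  simp only [← Finset.mul_sum, sum_centered hM, mul_zero, Finset.sum_const_zero]

theorem exists_targetCov_diagonalization {n M : ℕ} (Y : Matrix (Fin n) (Fin M) ℝ) :
    ∃ U : Matrix (Fin n) (Fin n) ℝ, U * U.transpose = 1 ∧ targetCov Y =
      U * Matrix.diagonal (targetCov_isHermitian Y).eigenvalues * U.transpose := by
  refine ⟨(targetCov_isHermitian Y).eigenvectorUnitary, ?_, ?_⟩
  · have := Unitary.coe_mul_star_self (targetCov_isHermitian Y).eigenvectorUnitary
    rwa [Unitary.coe_star, Matrix.star_eq_conjTranspose, Matrix.conjTranspose_eq_transpose_of_trivial] at this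
  · have := (targetCov_isHermitian Y).spectral_theorem
    rw [Unitary.conjStarAlgAut_apply, Matrix.star_eq_conjTranspose,
      Matrix.conjTranspose_eq_transpose_of_trivial] at this
    exact this

theorem sum_eigenvalues_eq_sum_targetEigenvalue {n M : ℕ} (Y : Matrix (Fin n) (Fin M) ℝ)
    (f : ℝ → ℝ) :
    ∑ i, f ((targetCov_isHermitian Y).eigenvalues i) = ∑ i, f (targetEigenvalue Y i) := by
  simp only [Matrix.IsHermitian.eigenvalues, targetEigenvalue]
  rw [Equiv.sum_comp (Fintype.equivOfCardEq (Fintype.card_fin _)).symm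
      (fun i => f ((targetCov_isHermitian Y).eigenvalues₀ i)),
    ← Equiv.sum_comp (finCongr (Fintype.card_fin n).symm)
      (fun i => f ((targetCov_isHermitian Y).eigenvalues₀ i))]
  rfl

theorem eigenvalues_pos_of_rank {n M : ℕ} {Y : Matrix (Fin n) (Fin M) ℝ}
    (hY : (targetCov Y).rank = n) (i : Fin n) : 0 < (targetCov_isHermitian Y).eigenvalues i := by
  refine lt_of_le_of_ne ((targetCov_posSemidef Y).eigenvalues_nonneg i) fun h => ?_
  rw [(targetCov_isHermitian Y).rank_eq_card_non_zero_eigs] at hY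
  have := Fintype.card_subtype_lt
    (p := fun i => (targetCov_isHermitian Y).eigenvalues i ≠ 0) (x := i) (by simp [h.symm])
  rw [Fintype.card_fin] at this
  omega

/-- For M = 0 the covariance is zero and has rank 0 < n. -/
theorem sample_size_ne_zero {n M : ℕ} (hn : 1 ≤ n) {Y : Matrix (Fin n) (Fin M) ℝ}
    (hY : (targetCov Y).rank = n) : M ≠ 0 := by
  rintro rfl
  simp [targetCov] at hY
  omega

/-! ### The threshold index and head and tail sums -/

theorem targetEigenvalue_antitone {n M : ℕ} (Y : Matrix (Fin n) (Fin M) ℝ) :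
    Antitone (targetEigenvalue Y) := fun _ _ h =>
  (targetCov_isHermitian Y).eigenvalues₀_antitone h

/-- The eigenvalues descend, so those at least c form an initial segment; the index is zero-based
while `jStar` counts from one. -/
theorem lt_jStar_iff {n M : ℕ} (Y : Matrix (Fin n) (Fin M) ℝ) (c : ℝ) (i : Fin n) :
    (i : ℕ) < jStar Y c ↔ c ≤ targetEigenvalue Y i := by
  rw [jStar, Finset.lt_sup_iff]
  constructor
  · rintro ⟨j, hj, hij⟩
    exact (Finset.mem_filter.1 hj).2.trans (targetEigenvalue_antitone Y (Nat.lt_succ_iff.1 hij))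
  · intro h
    exact ⟨i, by simp [h], Nat.lt_succ_self _⟩

theorem jStar_le {n M : ℕ} (Y : Matrix (Fin n) (Fin M) ℝ) (c : ℝ) : jStar Y c ≤ n :=
  Finset.sup_le fun i _ => i.2

theorem card_lt_jStar {n M : ℕ} (Y : Matrix (Fin n) (Fin M) ℝ) (c : ℝ) :
    (Finset.univ.filter (fun i : Fin n => (i : ℕ) < jStar Y c)).card = jStar Y c := by
  rw [Fin.card_filter_val_lt, min_eq_right (jStar_le Y c)]

theorem headSum_add_tailSum {n M : ℕ} (Y : Matrix (Fin n) (Fin M) ℝ) (c : ℝ) :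
    headSum Y c + tailSum Y c = ∑ i, targetEigenvalue Y i := by
  rw [headSum, tailSum]
  simp only [← not_lt]
  exact Finset.sum_filter_add_sum_filter_not _ _ _

theorem sum_min_targetEigenvalue {n M : ℕ} (Y : Matrix (Fin n) (Fin M) ℝ) (c : ℝ) :
    ∑ i, min (targetEigenvalue Y i) c = jStar Y c * c + tailSum Y c := by
  rw [← Finset.sum_filter_add_sum_filter_not _ (fun i : Fin n => (i : ℕ) < jStar Y c), tailSum]
  congr 1
  · rw [← congrArg (Nat.cast (R := ℝ)) (card_lt_jStar Y c), ← nsmul_eq_mul, ← Finset.sum_const]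
    refine Finset.sum_congr rfl fun i hi => min_eq_right ?_
    exact (lt_jStar_iff Y c i).1 (Finset.mem_filter.1 hi).2
  · simp only [not_lt]
    refine Finset.sum_congr rfl fun i hi => min_eq_left ?_
    have := (lt_jStar_iff Y c i).not.1 (not_lt.2 (Finset.mem_filter.1 hi).2)
    exact (not_le.1 this).le

theorem jStar_mul_le_headSum {n M : ℕ} (Y : Matrix (Fin n) (Fin M) ℝ) (c : ℝ) :
    jStar Y c * c ≤ headSum Y c := by
  rw [headSum, ← congrArg (Nat.cast (R := ℝ)) (card_lt_jStar Y c), ← nsmul_eq_mul,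
    ← Finset.sum_const]
  exact Finset.sum_le_sum fun i hi => (lt_jStar_iff Y c i).1 (Finset.mem_filter.1 hi).2

theorem headSum_eq_jStar_mul_iff {n M : ℕ} (Y : Matrix (Fin n) (Fin M) ℝ) (c : ℝ) :
    headSum Y c = jStar Y c * c ↔
      ∀ i : Fin n, (i : ℕ) < jStar Y c → targetEigenvalue Y i = c := by
  rw [headSum, ← congrArg (Nat.cast (R := ℝ)) (card_lt_jStar Y c), ← nsmul_eq_mul,
    ← Finset.sum_const, eq_comm, Finset.sum_eq_sum_iff_of_le
      fun i hi => (lt_jStar_iff Y c i).1 (Finset.mem_filter.1 hi).2]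
  simp [eq_comm]

/-! ### The error without whitening -/

theorem noWhiteningMSEs_eq {n d M : ℕ} (hn : 1 ≤ n) (hd : n ≤ d) {Y : Matrix (Fin n) (Fin M) ℝ}
    (hY : (targetCov Y).rank = n) {lamH lamW : ℝ} (hH : 0 < lamH) (hW : 0 < lamW) :
    noWhiteningMSEs d lamH lamW Y = {∑ i, min (targetEigenvalue Y i) (lamH * lamW)} := by
  have hM := sample_size_ne_zero hn hY
  have hM0 : (0 : ℝ) < M := Nat.cast_pos.2 (Nat.pos_of_ne_zero hM)
  obtain ⟨U, hU, hS⟩ := exists_targetCov_diagonalization Y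
  obtain ⟨R, W₀, H₀, K, ⟨D, hD⟩, hRR, hlow, heq⟩ := exists_soft_threshold hd hU
    (eigenvalues_pos_of_rank hY) (by rw [centered_mul_transpose hM, ← hS]) hH hW
  have hR : 1 / (M : ℝ) * frobSq R = ∑ i, min (targetEigenvalue Y i) (lamH * lamW) := by
    rw [frobSq_eq_trace, hRR, Matrix.trace_smul, Matrix.trace_mul_comm, ← Matrix.mul_assoc,
      mul_eq_one_comm.1 hU, Matrix.one_mul, Matrix.trace_diagonal,
      sum_eigenvalues_eq_sum_targetEigenvalue Y (fun x => min x (lamH * lamW)), smul_eq_mul]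
    field_simp
  have hloss : ∀ (H : Matrix (Fin d) (Fin M) ℝ) (W : Matrix (Fin n) (Fin d) ℝ) (b : Fin n → ℝ),
      ufmLoss lamH lamW Y H W b = 1 / (2 * M) * (frobSq (W * H +
        Matrix.replicateCol (Fin M) (b - targetMean Y) - (Y - meanMatrix Y)) + lamH * frobSq H +
        M * lamW * frobSq W) := by
    intro H W b
    have : W * H + Matrix.replicateCol (Fin M) (b - targetMean Y) - (Y - meanMatrix Y) =
        W * H + Matrix.replicateCol (Fin M) b - Y := by
      ext i j
      simp only [meanMatrix, Matrix.sub_apply, Matrix.add_apply, Matrix.replicateCol_apply,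
        Pi.sub_apply]
      ring
    rw [ufmLoss, this]
    field_simp
  have hbase : ufmLoss lamH lamW Y H₀ W₀ (targetMean Y) = 1 / (2 * M) * K := by
    rw [hloss, ← heq]
    simp
  have hge : ∀ (H : Matrix (Fin d) (Fin M) ℝ) (W : Matrix (Fin n) (Fin d) ℝ) (b : Fin n → ℝ),
      1 / (2 * (M : ℝ)) * (frobSq (W * H + Matrix.replicateCol (Fin M)
      (b - targetMean Y) - (Y - meanMatrix Y - R)) + K) ≤ ufmLoss lamH lamW Y H W b := by
    intro H W b
    rw [hloss]
    refine mul_le_mul_of_nonneg_left (hlow W H _ ?_) (by positivity)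
    rw [hD]
    exact trace_replicateCol_mul_centered hM Y _ _
  have hmin : ∀ (H : Matrix (Fin d) (Fin M) ℝ) (W : Matrix (Fin n) (Fin d) ℝ) b,
      ufmLoss lamH lamW Y H₀ W₀ (targetMean Y) ≤ ufmLoss lamH lamW Y H W b := by
    intro H W b
    refine le_trans ?_ (hge H W b)
    rw [hbase]
    exact mul_le_mul_of_nonneg_left (le_add_of_nonneg_left (frobSq_nonneg _)) (by positivity)
  have hval : ∀ (H : Matrix (Fin d) (Fin M) ℝ) W b,
      (∀ (H' : Matrix (Fin d) (Fin M) ℝ) W' b',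
        ufmLoss lamH lamW Y H W b ≤ ufmLoss lamH lamW Y H' W' b') →
      ufmMSE Y H W b = ∑ i, min (targetEigenvalue Y i) (lamH * lamW) := by
    intro H W b h
    -- A minimizer's loss is at most K/(2M), which leaves no room for the extra square in `hge`.
    have h1 := (hge H W b).trans (h H₀ W₀ (targetMean Y))
    rw [hbase] at h1
    have h2 := le_of_mul_le_mul_left h1 (by positivity)
    have h3 := sub_eq_zero.1 (frobSq_eq_zero_iff.1
      (le_antisymm (by linarith) (frobSq_nonneg (W * H + Matrix.replicateCol (Fin M)
        (b - targetMean Y) - (Y - meanMatrix Y - R)))))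
    have h4 : W * H + Matrix.replicateCol (Fin M) b - Y = (-1 : ℝ) • R := by
      have hb : Matrix.replicateCol (Fin M) (b - targetMean Y) =
          Matrix.replicateCol (Fin M) b - meanMatrix Y := rfl
      rw [hb, ← sub_eq_zero] at h3
      rw [neg_one_smul, ← sub_eq_zero, ← h3]
      abel
    rw [ufmMSE, h4, frobSq_smul, ← hR]
    ring
  ext m
  constructor
  · rintro ⟨H, W, b, h, rfl⟩
    exact hval H W b h
  · rintro rfl
    exact ⟨H₀, W₀, targetMean Y, fun H W b => hmin H W b, (hval _ _ _ fun H W b => hmin H W b).symm⟩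

/-! ### The error after whitening and de-whitening -/

theorem whitenedTargets_spec {n M : ℕ} (hM : M ≠ 0) {Y : Matrix (Fin n) (Fin M) ℝ}
    (hY : (targetCov Y).rank = n) :
    CFC.sqrt (targetCov Y) * whitenedTargets Y = Y - meanMatrix Y ∧
      whitenedTargets Y * (whitenedTargets Y).transpose = (M : ℝ) • 1 := by
  have hnn : 0 ≤ targetCov Y := Matrix.nonneg_iff_posSemidef.2 (targetCov_posSemidef Y)
  have hsq := CFC.sqrt_mul_sqrt_self (targetCov Y) hnn
  have hsymm : (CFC.sqrt (targetCov Y)).transpose = CFC.sqrt (targetCov Y) := by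
    have := (Matrix.nonneg_iff_posSemidef.1 (CFC.sqrt_nonneg (targetCov Y))).isHermitian.eq
    rwa [Matrix.conjTranspose_eq_transpose_of_trivial] at this
  have hunit : IsUnit (CFC.sqrt (targetCov Y)) := by
    rw [CFC.isUnit_sqrt_iff _ hnn, Matrix.isUnit_iff_isUnit_det,
      (targetCov_isHermitian Y).det_eq_prod_eigenvalues]
    exact (Finset.prod_ne_zero_iff.2 fun i _ => (eigenvalues_pos_of_rank hY i).ne').isUnit
  rw [Matrix.isUnit_iff_isUnit_det] at hunit
  constructor
  · rw [whitenedTargets, Matrix.mul_nonsing_inv_cancel_left _ _ hunit]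
  · rw [whitenedTargets, Matrix.transpose_mul, Matrix.mul_assoc,
      ← Matrix.mul_assoc (Y - meanMatrix Y), centered_mul_transpose hM,
      Matrix.transpose_nonsing_inv, hsymm]
    nth_rewrite 2 [← hsq]
    rw [Matrix.smul_mul, Matrix.mul_smul, Matrix.mul_nonsing_inv_cancel_right _ _ hunit,
      Matrix.nonsing_inv_mul _ hunit]

theorem deWhitenMSEs_eq {n d M : ℕ} (hn : 1 ≤ n) (hd : n ≤ d) {Y : Matrix (Fin n) (Fin M) ℝ}
    (hY : (targetCov Y).rank = n) {lamH lamW : ℝ} (hH : 0 < lamH) (hW : 0 < lamW) :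
    deWhitenMSEs d lamH lamW Y = {min 1 (lamH * lamW) * ∑ i, targetEigenvalue Y i} := by
  have hM := sample_size_ne_zero hn hY
  have hM0 : (0 : ℝ) < M := Nat.cast_pos.2 (Nat.pos_of_ne_zero hM)
  obtain ⟨hTX, hXX⟩ := whitenedTargets_spec hM hY
  -- Identity covariance: U = 1 and every eigenvalue is 1, so one threshold min(1, c) serves all
  -- directions.
  obtain ⟨R, W₀, H₀, K, -, hRR, hlow, heq⟩ := exists_soft_threshold (U := 1)
    (lam := fun _ => 1) hd (by simp) (fun _ => one_pos) (by simpa using hXX) hH hW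
  have hdiag : (Matrix.diagonal fun _ : Fin n => min 1 (lamH * lamW)) =
      min 1 (lamH * lamW) • (1 : Matrix (Fin n) (Fin n) ℝ) := by
    rw [Matrix.smul_one_eq_diagonal]
  rw [Matrix.transpose_one, Matrix.mul_one, Matrix.one_mul, hdiag] at hRR
  have hnn : 0 ≤ targetCov Y := Matrix.nonneg_iff_posSemidef.2 (targetCov_posSemidef Y)
  have hR : 1 / (M : ℝ) * frobSq (CFC.sqrt (targetCov Y) * R) =
      min 1 (lamH * lamW) * ∑ i, targetEigenvalue Y i := by
    have hsymm := (Matrix.nonneg_iff_posSemidef.1 (CFC.sqrt_nonneg (targetCov Y))).isHermitian.eq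
    rw [Matrix.conjTranspose_eq_transpose_of_trivial] at hsymm
    rw [frobSq_eq_trace, Matrix.transpose_mul, Matrix.mul_assoc, ← Matrix.mul_assoc R, hRR, hsymm,
      Matrix.smul_mul, Matrix.smul_mul, Matrix.one_mul, Matrix.mul_smul, Matrix.mul_smul,
      CFC.sqrt_mul_sqrt_self _ hnn, Matrix.trace_smul, Matrix.trace_smul,
      (targetCov_isHermitian Y).trace_eq_sum_eigenvalues,
      ← sum_eigenvalues_eq_sum_targetEigenvalue Y (fun x => x)]
    simp only [smul_eq_mul, RCLike.ofReal_real_eq_id, id]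
    field_simp
  have hloss : ∀ (H : Matrix (Fin d) (Fin M) ℝ) (W : Matrix (Fin n) (Fin d) ℝ),
      ufmLossNoBias lamH lamW (whitenedTargets Y) H W =
        1 / (2 * M) * (frobSq (W * H - whitenedTargets Y) + lamH * frobSq H +
        M * lamW * frobSq W) := by
    intro H W
    rw [ufmLossNoBias]
    field_simp
  have hbase : ufmLossNoBias lamH lamW (whitenedTargets Y) H₀ W₀ = 1 / (2 * M) * K := by
    rw [hloss, ← heq]
  have hge : ∀ (H : Matrix (Fin d) (Fin M) ℝ) (W : Matrix (Fin n) (Fin d) ℝ),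
      1 / (2 * (M : ℝ)) * (frobSq (W * H - (whitenedTargets Y - R)) + K) ≤
      ufmLossNoBias lamH lamW (whitenedTargets Y) H W := by
    intro H W
    rw [hloss]
    have := hlow W H 0 (by simp)
    rw [add_zero] at this
    exact mul_le_mul_of_nonneg_left this (by positivity)
  have hmin : ∀ (H : Matrix (Fin d) (Fin M) ℝ) (W : Matrix (Fin n) (Fin d) ℝ),
      ufmLossNoBias lamH lamW (whitenedTargets Y) H₀ W₀ ≤
      ufmLossNoBias lamH lamW (whitenedTargets Y) H W := by
    intro H W
    refine le_trans ?_ (hge H W)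
    rw [hbase]
    exact mul_le_mul_of_nonneg_left (le_add_of_nonneg_left (frobSq_nonneg _)) (by positivity)
  have hval : ∀ (H : Matrix (Fin d) (Fin M) ℝ) W,
      (∀ (H' : Matrix (Fin d) (Fin M) ℝ) W', ufmLossNoBias lamH lamW (whitenedTargets Y) H W ≤
        ufmLossNoBias lamH lamW (whitenedTargets Y) H' W') →
      1 / (M : ℝ) * frobSq (deWhitenedPrediction Y H W - Y) =
        min 1 (lamH * lamW) * ∑ i, targetEigenvalue Y i := by
    intro H W h
    have h1 := (hge H W).trans (h H₀ W₀)
    rw [hbase] at h1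
    have h2 := le_of_mul_le_mul_left h1 (by positivity)
    have h3 := sub_eq_zero.1 (frobSq_eq_zero_iff.1
      (le_antisymm (by linarith) (frobSq_nonneg (W * H - (whitenedTargets Y - R)))))
    have h4 : deWhitenedPrediction Y H W - Y = (-1 : ℝ) • (CFC.sqrt (targetCov Y) * R) := by
      rw [deWhitenedPrediction, h3, Matrix.mul_sub, hTX, neg_one_smul]
      abel
    rw [h4, frobSq_smul, ← hR]
    ring
  ext m
  constructor
  · rintro ⟨H, W, h, rfl⟩
    exact hval H W h
  · rintro rfl
    exact ⟨H₀, W₀, fun H W => hmin H W, (hval _ _ fun H W => hmin H W).symm⟩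

/-! ### Comparison of the two errors -/

theorem theorem5p2 (n d M : ℕ) (hn : 1 ≤ n) (hd : n ≤ d)
    (Y : Matrix (Fin n) (Fin M) ℝ) (hY : (targetCov Y).rank = n)
    (lamH lamW c : ℝ) (hH : 0 < lamH) (hW : 0 < lamW) (hc : c = lamH * lamW) :
    ∃ mseNo mseWh : ℝ,
      -- the two training errors are well defined: minimizers exist, and all give the same error
      noWhiteningMSEs d lamH lamW Y = {mseNo} ∧
      deWhitenMSEs d lamH lamW Y = {mseWh} ∧
      (c ≤ 1 →
        (mseWh < mseNo ↔ headSum Y c - (jStar Y c : ℝ) < c⁻¹ * (1 - c) * tailSum Y c) ∧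
        (mseWh > mseNo ↔ headSum Y c - (jStar Y c : ℝ) > c⁻¹ * (1 - c) * tailSum Y c) ∧
        (mseWh = mseNo ↔ headSum Y c - (jStar Y c : ℝ) = c⁻¹ * (1 - c) * tailSum Y c) ∧
        (c < targetEigenvalue Y ⟨n - 1, by omega⟩ →
          jStar Y c = n ∧
          (headSum Y c - (jStar Y c : ℝ) < c⁻¹ * (1 - c) * tailSum Y c ↔
            (∑ i, targetEigenvalue Y i) / (n : ℝ) < 1) ∧
          (headSum Y c - (jStar Y c : ℝ) > c⁻¹ * (1 - c) * tailSum Y c ↔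
            (∑ i, targetEigenvalue Y i) / (n : ℝ) > 1) ∧
          (headSum Y c - (jStar Y c : ℝ) = c⁻¹ * (1 - c) * tailSum Y c ↔
            (∑ i, targetEigenvalue Y i) / (n : ℝ) = 1))) ∧
      (1 < c →
        mseNo ≤ mseWh ∧
        (mseWh = mseNo ↔
          ∀ i : Fin n, (i : ℕ) < jStar Y c → targetEigenvalue Y i = c)) := by
  have hc0 : 0 < c := hc ▸ mul_pos hH hW
  have hn0 : (0 : ℝ) < n := Nat.cast_pos.2 hn
  have hsum := headSum_add_tailSum Y c
  have hinv : c * (c⁻¹ * (1 - c) * tailSum Y c) = (1 - c) * tailSum Y c := by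
    field_simp
  refine ⟨_, _, noWhiteningMSEs_eq hn hd hY hH hW, deWhitenMSEs_eq hn hd hY hH hW, ?_, ?_⟩
  · intro hc1
    rw [← hc, sum_min_targetEigenvalue, min_eq_right hc1, ← hsum]
    -- Multiplying by c > 0 clears c⁻¹ and turns each relation into one between c·(head + tail) and
    -- j*·c + tail.
    have hlt : ∀ a b : ℝ, a < b ↔ c * a < c * b := fun a b => (mul_lt_mul_iff_right₀ hc0).symm
    have heq : ∀ a b : ℝ, a = b ↔ c * a = c * b := fun a b => (mul_right_inj' hc0.ne').symm
    refine ⟨?_, ?_, ?_, ?_⟩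
    · rw [hlt (headSum Y c - _), hinv]
      constructor <;> intro h <;> nlinarith
    · rw [gt_iff_lt, gt_iff_lt, hlt _ (headSum Y c - _), hinv]
      constructor <;> intro h <;> nlinarith
    · rw [heq (headSum Y c - _), hinv]
      constructor <;> intro h <;> nlinarith
    · intro hmin
      have hj : jStar Y c = n := by
        have := (lt_jStar_iff Y c ⟨n - 1, by omega⟩).2 hmin.le
        have h2 := jStar_le Y c
        simp only at this
        omega
      have htail : tailSum Y c = 0 := by
        rw [tailSum, hj]
        refine Finset.sum_eq_zero fun i hi => ?_
        exact absurd i.2 (not_lt.2 (Finset.mem_filter.1 hi).2)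
      rw [htail, add_zero, hj, mul_zero, gt_iff_lt, gt_iff_lt, div_lt_one hn0, one_lt_div hn0,
        div_eq_one_iff_eq hn0.ne', sub_neg, sub_pos, sub_eq_zero]
      exact ⟨rfl, Iff.rfl, Iff.rfl, Iff.rfl⟩
  · intro hc1
    rw [← hc, sum_min_targetEigenvalue, min_eq_left hc1.le, ← hsum, one_mul,
      ← headSum_eq_jStar_mul_iff, add_left_inj]
    exact ⟨by linarith [jStar_mul_le_headSum Y c], Iff.rfl⟩
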